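/- Let $N\ge 1$, $d_1,\dots,d_N\ge 1$, $d=\max_j d_j$. Equip the real tensors in $\mathbb{R}^{d_1\times\cdots\times d_N}$ with the entrywise inner product $\langle A,B\rangle$ and the Frobenius norm $\|A\|_F=\sqrt{\langle A,A\rangle}$. For $j\in\{1,\dots,N\}$ let $\mathcal{M}_j(A)$ be the mode-$j$ unfolding of $A$, a matrix with $d_j$ rows and $\prod_{i\ne j}d_i$ columns. Let $$\mathcal{R}(A)=\|A\|_*=\frac1N\sum_{j=1}^N\|\mathcal{M}_j(A)\|_*$$ be the tensor nuclear norm (the average of the matrix nuclear norms of the unfoldings), and let $\mathcal{R}^*(A)=\sup\{\langle A,B\rangle:\mathcal{R}(B)\le 1\}$ be its dual norm. Let $T_1\ge1$. Let $\mathcal{X}_1,\dots,\mathcal{X}_{T_1}$ be random tensors with $\|\mathcal{X}_t\|_F\le 1$ almost surely (the contexts selected in the $T_1$ exploration rounds), and let $\varepsilon_1,\dots,\varepsilon_{T_1}$ be real noise variables such that, for some $R>0$ and every $t$, $\varepsilon_t$ is $R$-sub-Gaussian conditionally on $\mathcal{X}_1,\dots,\mathcal{X}_t,\varepsilon_1,\dots,\varepsilon_{t-1}$: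 for every real $s$, $e^{s\varepsilon_t}$ is integrable and $$\mathbb{E}\big[e^{s\varepsilon_t}\,\big|\,\mathcal{X}_1,\dots,\mathcal{X}_t,\varepsilon_1,\dots,\varepsilon_{t-1}\big]\le e^{s^2R^2/2}\quad\text{almost surely.}$$ (This holds in particular if the $\varepsilon_t$ are independent of each other and of the $\mathcal{X}_t$, and each is $R$-sub-Gaussian.) Let $0<c_R\le1$, $\alpha=\frac{c_R+3}{2c_R}$, $\delta\in(0,1)$ and $$\lambda_{T_1}=\frac{\alpha R N}{\sqrt{T_1}}\sqrt{2\log\frac{4T_1N}{\delta}\,\log\frac{2N(d+d^{N-1})}{\delta}}.$$ Then, with probability at least $1-\delta$, both $$\lambda_{T_1}\ge\alpha\,\mathcal{R}^*\Big(\frac1{T_1}\sum_{t=1}^{T_1}\varepsilon_t\mathcal{X}_t\Big)\qquad\text{and}\qquad\lambda_{T_1}\ge\alpha N\max_{1\le j\le N}\Big\|\mathcal{M}_j\Big(\frac1{T_1}\sum_{t=1}^{T_1}\varepsilon_t\mathcal{X}_t\Big)\Big\|,$$ where $\|\cdot\|$ is the spectral norm of a matrix. -/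

import Mathlib

open MeasureTheory

/-- Real tensors of order `N` and size `d 0 × ⋯ × d (N - 1)`. -/
abbrev Tensor {N : ℕ} (d : Fin N → ℕ) : Type :=
  ((j : Fin N) → Fin (d j)) → ℝ

/-- Entrywise inner product of tensors. -/
noncomputable def tensorInner {N : ℕ} {d : Fin N → ℕ} (A B : Tensor d) : ℝ :=
  ∑ i, A i * B i

/-- Frobenius norm of a tensor. -/
noncomputable def frobeniusNorm {N : ℕ} {d : Fin N → ℕ} (A : Tensor d) : ℝ :=
  √(tensorInner A A)

/-- Mode-`n` unfolding: rows are indexed by the `n`-th index, columns by the tuple of all the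
other indices (how the columns are listed does not affect any quantity used below). -/
def unfold {N : ℕ} {d : Fin N → ℕ} (n : Fin N) (A : Tensor d) :
    Matrix (Fin (d n)) ((j : {j : Fin N // j ≠ n}) → Fin (d j)) ℝ :=
  Matrix.of fun i k => A ((Equiv.piSplitAt n fun j => Fin (d j)).symm (i, k))

/-- Nuclear norm of a real matrix: the sum of its singular values. -/
noncomputable def matrixNuclearNorm {m n : Type} [Fintype m] [Fintype n] [DecidableEq n]
    (A : Matrix m n ℝ) : ℝ :=
  (Matrix.toEuclideanLin A).singularValues.sum fun _ s => s

open scoped Matrix.Norms.L2Operator in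
/-- Spectral norm of a real matrix: the operator norm between Euclidean spaces. -/
noncomputable def matrixSpectralNorm {m n : Type} [Fintype m] [Fintype n] [DecidableEq n]
    (A : Matrix m n ℝ) : ℝ :=
  ‖A‖

/-- Tensor nuclear norm: the average of the nuclear norms of the `N` unfoldings. -/
noncomputable def tensorNuclearNorm {N : ℕ} {d : Fin N → ℕ} (A : Tensor d) : ℝ :=
  (1 / (N : ℝ)) * ∑ j : Fin N, matrixNuclearNorm (unfold j A)

/-- The norm dual to a norm `F` on tensors, with respect to the entrywise inner product. -/
noncomputable def dualNorm {N : ℕ} {d : Fin N → ℕ} (F : Tensor d → ℝ) (A : Tensor d) : ℝ :=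
  sSup {x : ℝ | ∃ B : Tensor d, F B ≤ 1 ∧ x = tensorInner A B}

/-- `N` times the largest spectral norm of an unfolding. -/
noncomputable def scaledMaxSpectralNorm {N : ℕ} {d : Fin N → ℕ} (A : Tensor d) : ℝ :=
  (N : ℝ) * ⨆ j : Fin N, matrixSpectralNorm (unfold j A)

/-- The history up to the noise of round `t`: generated by the tensors selected in rounds
`s ≤ t` and the noise variables of rounds `s < t`. -/
@[reducible] def history {Ω : Type*} {N : ℕ} {d : Fin N → ℕ} {T : ℕ}
    (X : Fin T → Ω → Tensor d) (ε : Fin T → Ω → ℝ) (t : Fin T) : MeasurableSpace Ω :=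
  (⨆ s : {s : Fin T // s ≤ t}, MeasurableSpace.comap (X s) inferInstance) ⊔
    ⨆ s : {s : Fin T // s < t}, MeasurableSpace.comap (ε s) inferInstance

/-- `Y` is conditionally `R`-sub-Gaussian given `m`:
`E[exp (s Y) | m] ≤ exp (s² R² / 2)` almost surely, for every real `s`. -/
def CondSubGaussian {Ω : Type*} {mΩ : MeasurableSpace Ω} (μ : Measure Ω)
    (m : MeasurableSpace Ω) (Y : Ω → ℝ) (R : ℝ) : Prop :=
  ∀ s : ℝ, Integrable (fun ω => Real.exp (s * Y ω)) μ ∧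
    ∀ᵐ ω ∂μ, (μ[fun ω' => Real.exp (s * Y ω') | m]) ω ≤ Real.exp (s ^ 2 * R ^ 2 / 2)

/-- The average `(1 / T) ∑ₜ εₜ Xₜ`. -/
noncomputable def noiseAverage {Ω : Type*} {N : ℕ} {d : Fin N → ℕ} {T : ℕ}
    (X : Fin T → Ω → Tensor d) (ε : Fin T → Ω → ℝ) (ω : Ω) : Tensor d :=
  (1 / (T : ℝ)) • ∑ t : Fin T, ε t ω • X t ω

/-- The largest of the dimensions `d 0, …, d (N - 1)`. -/
def maxDim {N : ℕ} (d : Fin N → ℕ) : ℕ := Finset.univ.sup d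

/-- The factor `α = (c_R + 3) / (2 c_R)`. -/
noncomputable def alphaOf (cR : ℝ) : ℝ := (cR + 3) / (2 * cR)

/-- The regularization parameter
`(α R N / √T) √(2 log (4 T N / δ) log (2 N (D + D ^ (N - 1)) / δ))`. -/
noncomputable def lambdaReg (α R δ : ℝ) (N T D : ℕ) : ℝ :=
  α * R * N / √(T : ℝ) *
    √(2 * Real.log (4 * T * N / δ) *
      Real.log (2 * N * ((D : ℝ) + (D : ℝ) ^ (N - 1)) / δ))

/-!
Both quantities to be bounded are at most `N` times the Frobenius norm of the noise average. A
spectral norm is at most the Frobenius norm, and every unfolding has the Frobenius norm of the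
tensor. A nuclear norm is at least the Frobenius norm (`ℓ¹` against `ℓ²` norm of the singular
values), so by Cauchy-Schwarz the dual of the tensor nuclear norm is at most the Frobenius norm.
It is therefore enough to bound `S = ∑ₜ εₜ Xₜ` in the Euclidean space of tensors, and no matrix
concentration inequality or union bound over the modes is needed.

The bound on `S` is a dimension-free martingale estimate. If `Y` is `R`-sub-Gaussian given the past
and `U`, `x` are determined by the past with `‖x‖ ≤ 1`, then for `κ = 2 b R² < 1`
`E exp (b ‖U + Y x‖²) ≤ (1 - κ)^(-1/2) E exp (b / (1 - κ) ‖U‖²)`,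
because `‖U + Y x‖² ≤ ‖U‖² + 2 Y ⟨U, x⟩ + Y²`, and the factor `exp (b Y²)` is a Gaussian average of
exponentials of multiples of `Y` (`lintegral_exp_add_sq_le`,
`CondSubGaussian.lintegral_exp_sq_add_smul_le`). The constants telescope over the rounds to
`E exp (b ‖S‖²) ≤ (1 - 2 b R² T)^(-1/2)` (`lintegral_exp_sq_partialSum_le`). With
`b = 1 / (4 R² T)`, Markov's inequality gives `‖S‖² ≤ 2 R² T (log 2 + 2 log (1 / δ))` with
probability at least `1 - δ`, and the product of the two logarithms in `lambdaReg` exceeds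
`log 2 + 2 log (1 / δ)` (`log_two_add_le_log_mul_log`).

The hypothesis on the noise has an exceptional null set for each exponent `s`, while `⟨U, x⟩` is
random. The conditional law of the noise (`condDistrib`) yields one null set for all `s`.
-/

/-! ### Singular values and the Frobenius norm of a matrix -/

lemma sum_sq_singularValues {m n : Type} [Fintype m] [Fintype n] [DecidableEq n]
    (A : Matrix m n ℝ) :
    ∑ k ∈ Finset.range (Module.finrank ℝ (EuclideanSpace ℝ n)),
        (Matrix.toEuclideanLin A).singularValues k ^ 2 = ∑ i, ∑ j, A i j ^ 2 := by
  set L := Matrix.toEuclideanLin A with hL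
  rw [← Fin.sum_univ_eq_sum_range fun k => L.singularValues k ^ 2]
  have htr := L.isSymmetric_adjoint_comp_self.trace_eq_sum_eigenvalues rfl
  simp_rw [L.sq_singularValues_fin rfl]
  calc ∑ k, L.isSymmetric_adjoint_comp_self.eigenvalues rfl k
      = LinearMap.trace ℝ _ (L.adjoint ∘ₗ L) := by simpa using htr.symm
    _ = ∑ j, ‖L (EuclideanSpace.single j 1)‖ ^ 2 := by
        rw [LinearMap.trace_eq_sum_inner _ (EuclideanSpace.basisFun n ℝ)]
        simp [LinearMap.adjoint_inner_right]
    _ = ∑ i, ∑ j, A i j ^ 2 := by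
        rw [Finset.sum_comm]
        refine Finset.sum_congr rfl fun j _ => ?_
        simp [EuclideanSpace.norm_sq_eq, hL, Matrix.toLpLin_apply]

lemma matrixNuclearNorm_eq_sum_range {m n : Type} [Fintype m] [Fintype n] [DecidableEq n]
    (A : Matrix m n ℝ) :
    matrixNuclearNorm A = ∑ k ∈ Finset.range (Module.finrank ℝ (EuclideanSpace ℝ n)),
      (Matrix.toEuclideanLin A).singularValues k := by
  refine Finsupp.sum_of_support_subset _ (fun k hk => ?_) _ fun _ _ => rfl
  by_contra h
  exact Finsupp.mem_support_iff.1 hk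
    (LinearMap.singularValues_of_finrank_le _ (by simpa using h))

/-- The Frobenius norm of a matrix is the `ℓ²` norm of its singular values, hence at most their
`ℓ¹` norm. -/
lemma sqrt_sum_sq_le_matrixNuclearNorm {m n : Type} [Fintype m] [Fintype n] [DecidableEq n]
    (A : Matrix m n ℝ) : √(∑ i, ∑ j, A i j ^ 2) ≤ matrixNuclearNorm A := by
  have h0 := fun k => LinearMap.singularValues_nonneg (Matrix.toEuclideanLin A) k
  rw [matrixNuclearNorm_eq_sum_range, ← sum_sq_singularValues]
  exact Real.sqrt_le_iff.2 ⟨Finset.sum_nonneg fun k _ => h0 k,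
    Finset.sum_sq_le_sq_sum_of_nonneg fun k _ => h0 k⟩

lemma matrixSpectralNorm_le_sqrt_sum_sq {m n : Type} [Fintype m] [Fintype n] [DecidableEq n]
    (A : Matrix m n ℝ) : matrixSpectralNorm A ≤ √(∑ i, ∑ j, A i j ^ 2) := by
  rw [matrixSpectralNorm, Matrix.l2_opNorm_def]
  refine ContinuousLinearMap.opNorm_le_bound _ (Real.sqrt_nonneg _) fun x => ?_
  rw [EuclideanSpace.norm_eq, EuclideanSpace.norm_eq, ← Real.sqrt_mul (by positivity)]
  refine Real.sqrt_le_sqrt ?_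
  rw [Finset.sum_mul]
  refine Finset.sum_le_sum fun i _ => ?_
  simpa [Matrix.toLpLin_apply, Matrix.mulVec, dotProduct] using
    Finset.sum_mul_sq_le_sq_mul_sq Finset.univ (A i) x

/-! ### Norms of tensors and their unfoldings -/

section Tensor

variable {N : ℕ} {d : Fin N → ℕ}

lemma tensorInner_self_nonneg (A : Tensor d) : 0 ≤ tensorInner A A :=
  Finset.sum_nonneg fun i _ => mul_self_nonneg (A i)

lemma sq_tensorInner_le (A B : Tensor d) :
    tensorInner A B ^ 2 ≤ tensorInner A A * tensorInner B B := by
  simpa [tensorInner, sq] using Finset.sum_mul_sq_le_sq_mul_sq Finset.univ A B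

lemma tensorInner_le_frobeniusNorm_mul (A B : Tensor d) :
    tensorInner A B ≤ frobeniusNorm A * frobeniusNorm B := by
  rw [frobeniusNorm, frobeniusNorm, ← Real.sqrt_mul (tensorInner_self_nonneg A)]
  exact Real.le_sqrt_of_sq_le (sq_tensorInner_le A B)

lemma frobeniusNorm_nonneg (A : Tensor d) : 0 ≤ frobeniusNorm A := Real.sqrt_nonneg _

lemma frobeniusNorm_smul (c : ℝ) (hc : 0 ≤ c) (A : Tensor d) :
    frobeniusNorm (c • A) = c * frobeniusNorm A := by
  have h : tensorInner (c • A) (c • A) = c ^ 2 * tensorInner A A := by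
    simp only [tensorInner, Finset.mul_sum, Pi.smul_apply, smul_eq_mul]
    exact Finset.sum_congr rfl fun i _ => by ring
  rw [frobeniusNorm, h, Real.sqrt_mul (sq_nonneg c), Real.sqrt_sq hc, frobeniusNorm]

lemma tensorInner_add_smul_self (U x : Tensor d) (y : ℝ) :
    tensorInner (U + y • x) (U + y • x) =
      tensorInner U U + 2 * tensorInner U x * y + tensorInner x x * y ^ 2 := by
  simp only [tensorInner, Finset.mul_sum, Finset.sum_mul, ← Finset.sum_add_distrib,
    Pi.add_apply, Pi.smul_apply, smul_eq_mul]
  exact Finset.sum_congr rfl fun i _ => by ring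

lemma sum_sq_unfold (j : Fin N) (A : Tensor d) :
    ∑ i, ∑ k, unfold j A i k ^ 2 = tensorInner A A := by
  rw [← Fintype.sum_prod_type', tensorInner]
  exact Fintype.sum_equiv (Equiv.piSplitAt j fun j => Fin (d j)).symm _ _ fun p => sq _

lemma matrixSpectralNorm_unfold_le (j : Fin N) (A : Tensor d) :
    matrixSpectralNorm (unfold j A) ≤ frobeniusNorm A := by
  rw [frobeniusNorm, ← sum_sq_unfold j]
  exact matrixSpectralNorm_le_sqrt_sum_sq _

lemma scaledMaxSpectralNorm_le (A : Tensor d) :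
    scaledMaxSpectralNorm A ≤ N * frobeniusNorm A :=
  mul_le_mul_of_nonneg_left
    (Real.iSup_le (fun j => matrixSpectralNorm_unfold_le j A) (frobeniusNorm_nonneg A))
    N.cast_nonneg

lemma frobeniusNorm_le_tensorNuclearNorm (hN : 1 ≤ N) (A : Tensor d) :
    frobeniusNorm A ≤ tensorNuclearNorm A := by
  have h : ∑ _j : Fin N, frobeniusNorm A ≤ ∑ j : Fin N, matrixNuclearNorm (unfold j A) :=
    Finset.sum_le_sum fun j _ => by
      rw [frobeniusNorm, ← sum_sq_unfold j]
      exact sqrt_sum_sq_le_matrixNuclearNorm _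
  have hN' : (0 : ℝ) < N := by exact_mod_cast hN
  rw [tensorNuclearNorm, one_div, inv_mul_eq_div, le_div_iff₀ hN']
  simpa [mul_comm] using h

/-- Passing to dual norms reverses `frobeniusNorm_le_tensorNuclearNorm`, and the Frobenius norm is
its own dual. -/
lemma dualNorm_tensorNuclearNorm_le (hN : 1 ≤ N) (A : Tensor d) :
    dualNorm tensorNuclearNorm A ≤ frobeniusNorm A := by
  refine Real.sSup_le ?_ (frobeniusNorm_nonneg A)
  rintro _ ⟨B, hB, rfl⟩
  calc tensorInner A B ≤ frobeniusNorm A * frobeniusNorm B := tensorInner_le_frobeniusNorm_mul A B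
    _ ≤ frobeniusNorm A * 1 := mul_le_mul_of_nonneg_left
        ((frobeniusNorm_le_tensorNuclearNorm hN B).trans hB) (frobeniusNorm_nonneg A)
    _ = frobeniusNorm A := mul_one _

lemma measurable_tensorInner {Ω : Type*} {m : MeasurableSpace Ω} {A B : Ω → Tensor d}
    (hA : Measurable A) (hB : Measurable B) : Measurable fun ω => tensorInner (A ω) (B ω) :=
  Finset.measurable_sum _ fun i _ =>
    ((measurable_pi_apply i).comp hA).mul ((measurable_pi_apply i).comp hB)

end Tensor

/-! ### The two logarithms in the regularization parameter -/

/-- Each of the two logarithms is at least `log 4 + log (1 / δ)`, and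
`(log 4 + l) ^ 2 ≥ log 2 + 2 * l` for `l ≥ 0` because `log 4 > 1`. -/
lemma log_two_add_le_log_mul_log {N T D : ℕ} (hN : 1 ≤ N) (hT : 1 ≤ T) (hD : 1 ≤ D) {δ : ℝ}
    (hδ₀ : 0 < δ) (hδ₁ : δ < 1) :
    Real.log 2 + 2 * Real.log (1 / δ) ≤
      Real.log (4 * T * N / δ) * Real.log (2 * N * ((D : ℝ) + (D : ℝ) ^ (N - 1)) / δ) := by
  have hN' : (1 : ℝ) ≤ N := by exact_mod_cast hN
  have hT' : (1 : ℝ) ≤ T := by exact_mod_cast hT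
  have hD' : (1 : ℝ) ≤ D := by exact_mod_cast hD
  have hDp : (1 : ℝ) ≤ (D : ℝ) ^ (N - 1) := one_le_pow₀ hD'
  have hl : 0 ≤ Real.log (1 / δ) := Real.log_nonneg (by rw [le_div_iff₀ hδ₀]; linarith)
  have h2 : (0.69 : ℝ) < Real.log 2 := by linarith [Real.log_two_gt_d9]
  have key : ∀ a : ℝ, 4 ≤ a → 2 * Real.log 2 + Real.log (1 / δ) ≤ Real.log (a / δ) := fun a ha => by
    have h4 : 2 * Real.log 2 = Real.log 4 := by
      rw [show (4 : ℝ) = 2 ^ 2 by norm_num, Real.log_pow]; norm_num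
    rw [h4, ← Real.log_mul (by norm_num) (by positivity), mul_one_div]
    exact Real.log_le_log (by positivity) (by gcongr)
  have h₁ := key (4 * T * N) (by nlinarith)
  have h₂ := key (2 * N * ((D : ℝ) + (D : ℝ) ^ (N - 1))) (by nlinarith)
  calc Real.log 2 + 2 * Real.log (1 / δ)
      ≤ (2 * Real.log 2 + Real.log (1 / δ)) * (2 * Real.log 2 + Real.log (1 / δ)) := by nlinarith
    _ ≤ _ := mul_le_mul h₁ h₂ (by positivity) (le_trans (by positivity) h₁)

/-! ### Exponential moments of sub-Gaussian variables -/

open ProbabilityTheory in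
lemma lintegral_exp_mul_gaussianReal (t : ℝ) :
    ∫⁻ g, ENNReal.ofReal (Real.exp (t * g)) ∂(gaussianReal 0 1) =
      ENNReal.ofReal (Real.exp (t ^ 2 / 2)) := by
  rw [← ofReal_integral_eq_lintegral_ofReal (integrable_exp_mul_gaussianReal t)
    (Filter.Eventually.of_forall fun _ => (Real.exp_pos _).le)]
  congr 1
  have := congrFun (mgf_fun_id_gaussianReal (μ := 0) (v := 1)) t
  simpa [mgf] using this

/-- The Gaussian integral of `exp ((s + c g)² r / 2)`: up to a constant, the integrand times the
standard Gaussian density is the Gaussian density with variance `1 / (1 - c² r)`. -/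
lemma lintegral_exp_sq_gaussianReal (s c r : ℝ) (h : c ^ 2 * r < 1) :
    ∫⁻ g, ENNReal.ofReal (Real.exp ((s + c * g) ^ 2 * r / 2)) ∂(ProbabilityTheory.gaussianReal 0 1) =
      ENNReal.ofReal ((√(1 - c ^ 2 * r))⁻¹ * Real.exp (s ^ 2 * r / (2 * (1 - c ^ 2 * r)))) := by
  set k := 1 - c ^ 2 * r with hk
  have hk0 : 0 < k := by linarith
  let v : NNReal := ⟨k⁻¹, by positivity⟩
  have hv : v ≠ 0 := fun h0 => (inv_pos.2 hk0).ne' (congrArg NNReal.toReal h0)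
  rw [ProbabilityTheory.gaussianReal_of_var_ne_zero _ one_ne_zero,
    lintegral_withDensity_eq_lintegral_mul _ (ProbabilityTheory.measurable_gaussianPDF 0 1)
      (by fun_prop)]
  have hpt : ∀ g : ℝ, (ProbabilityTheory.gaussianPDF 0 1 *
      fun g => ENNReal.ofReal (Real.exp ((s + c * g) ^ 2 * r / 2))) g =
      ENNReal.ofReal ((√k)⁻¹ * Real.exp (s ^ 2 * r / (2 * k))) *
        ProbabilityTheory.gaussianPDF (r * s * c / k) v g := fun g => by
    rw [Pi.mul_apply, ProbabilityTheory.gaussianPDF, ProbabilityTheory.gaussianPDF,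
      ← ENNReal.ofReal_mul (ProbabilityTheory.gaussianPDFReal_nonneg _ _ _),
      ← ENNReal.ofReal_mul (by positivity)]
    congr 1
    have hvk : (v : ℝ) = k⁻¹ := rfl
    simp only [ProbabilityTheory.gaussianPDFReal, hvk]
    rw [← div_eq_mul_inv (2 * Real.pi) k, Real.sqrt_div (by positivity)]
    have hsk : √k ≠ 0 := (Real.sqrt_pos.2 hk0).ne'
    have hsp : √(2 * Real.pi) ≠ 0 := (Real.sqrt_pos.2 (by positivity)).ne'
    rw [inv_div, NNReal.coe_one, mul_one, mul_assoc, ← Real.exp_add,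
      show (√k)⁻¹ * Real.exp (s ^ 2 * r / (2 * k)) *
        (√k / √(2 * Real.pi) * Real.exp (-(g - r * s * c / k) ^ 2 / (2 * k⁻¹))) =
        (√(2 * Real.pi))⁻¹ * (Real.exp (s ^ 2 * r / (2 * k)) *
          Real.exp (-(g - r * s * c / k) ^ 2 / (2 * k⁻¹))) by field_simp, ← Real.exp_add]
    congr 2
    have hc : c ^ 2 * r = 1 - k := by linarith
    field_simp
    have e : k = 1 - c ^ 2 * r := hk
    rw [e]; ring
  rw [lintegral_congr hpt, lintegral_const_mul _ (ProbabilityTheory.measurable_gaussianPDF _ _),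
    ProbabilityTheory.lintegral_gaussianPDF_eq_one _ hv, mul_one]

/-- A sub-Gaussian law integrates `exp (s y + b y²)` for `2 b R² < 1`: write `exp (b y²)` as the
Gaussian average of `exp (√(2 b) g y)` and exchange the two integrals. -/
lemma lintegral_exp_add_sq_le (ν : Measure ℝ) [IsProbabilityMeasure ν] (R b s : ℝ) (hb : 0 ≤ b)
    (hbR : 2 * b * R ^ 2 < 1)
    (hν : ∀ t : ℝ, ∫⁻ y, ENNReal.ofReal (Real.exp (t * y)) ∂ν ≤
      ENNReal.ofReal (Real.exp (t ^ 2 * R ^ 2 / 2))) :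
    ∫⁻ y, ENNReal.ofReal (Real.exp (s * y + b * y ^ 2)) ∂ν ≤
      ENNReal.ofReal ((√(1 - 2 * b * R ^ 2))⁻¹ *
        Real.exp (s ^ 2 * R ^ 2 / (2 * (1 - 2 * b * R ^ 2)))) := by
  have hc : √(2 * b) ^ 2 = 2 * b := Real.sq_sqrt (by positivity)
  calc ∫⁻ y, ENNReal.ofReal (Real.exp (s * y + b * y ^ 2)) ∂ν
      = ∫⁻ y, ∫⁻ g, ENNReal.ofReal (Real.exp ((s + √(2 * b) * g) * y))
          ∂(ProbabilityTheory.gaussianReal 0 1) ∂ν := by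
        refine lintegral_congr fun y => ?_
        have e : ∀ g : ℝ, ENNReal.ofReal (Real.exp ((s + √(2 * b) * g) * y)) =
            ENNReal.ofReal (Real.exp (s * y)) *
              ENNReal.ofReal (Real.exp (√(2 * b) * y * g)) := fun g => by
          rw [← ENNReal.ofReal_mul (Real.exp_pos _).le, ← Real.exp_add]
          ring_nf
        rw [lintegral_congr e, lintegral_const_mul _ (by fun_prop),
          lintegral_exp_mul_gaussianReal, ← ENNReal.ofReal_mul (Real.exp_pos _).le,
          ← Real.exp_add, mul_pow, hc]
        ring_nf
    _ = ∫⁻ g, ∫⁻ y, ENNReal.ofReal (Real.exp ((s + √(2 * b) * g) * y)) ∂ν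
          ∂(ProbabilityTheory.gaussianReal 0 1) :=
        lintegral_lintegral_swap (Measurable.aemeasurable (by fun_prop))
    _ ≤ ∫⁻ g, ENNReal.ofReal (Real.exp ((s + √(2 * b) * g) ^ 2 * R ^ 2 / 2))
          ∂(ProbabilityTheory.gaussianReal 0 1) := lintegral_mono fun g => hν _
    _ = _ := by
        rw [lintegral_exp_sq_gaussianReal _ _ _ (by rwa [hc]), hc]

/-- The law of `Y` given `H` is sub-Gaussian almost surely, with a single null set for all
exponents: the hypothesis gives this for rational `s`, and Fatou's lemma for the others. -/
lemma CondSubGaussian.ae_lintegral_condDistrib_le {Ω β : Type*} {mΩ : MeasurableSpace Ω}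
    [mβ : MeasurableSpace β] {μ : Measure Ω} [IsProbabilityMeasure μ] {H : Ω → β}
    (hH : Measurable H) {Y : Ω → ℝ} (hY : Measurable Y) {R : ℝ}
    (h : CondSubGaussian μ (mβ.comap H) Y R) :
    ∀ᵐ ω ∂μ, ∀ s : ℝ,
      ∫⁻ y, ENNReal.ofReal (Real.exp (s * y)) ∂(ProbabilityTheory.condDistrib Y H μ (H ω)) ≤
        ENNReal.ofReal (Real.exp (s ^ 2 * R ^ 2 / 2)) := by
  have hq : ∀ᵐ ω ∂μ, ∀ q : ℚ,
      ∫⁻ y, ENNReal.ofReal (Real.exp (q * y)) ∂(ProbabilityTheory.condDistrib Y H μ (H ω)) ≤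
        ENNReal.ofReal (Real.exp ((q : ℝ) ^ 2 * R ^ 2 / 2)) := by
    refine ae_all_iff.2 fun q => ?_
    have hexp : StronglyMeasurable fun y : ℝ => Real.exp ((q : ℝ) * y) :=
      Measurable.stronglyMeasurable (by fun_prop)
    have hce := ProbabilityTheory.condExp_ae_eq_integral_condDistrib hH
      hY.aemeasurable hexp (h q).1
    have hint : ∀ᵐ ω ∂μ, Integrable (fun y : ℝ => Real.exp ((q : ℝ) * y))
        (ProbabilityTheory.condDistrib Y H μ (H ω)) :=
      Integrable.condDistrib_ae (f := fun p : β × ℝ => Real.exp ((q : ℝ) * p.2))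
        hH.aemeasurable hY.aemeasurable <|
        (integrable_map_measure
          (Measurable.stronglyMeasurable (by fun_prop)).aestronglyMeasurable
          (hH.prodMk hY).aemeasurable).2 (h q).1
    filter_upwards [hce, hint, (h q).2] with ω h₁ h₂ h₃
    rw [← ofReal_integral_eq_lintegral_ofReal h₂
      (Filter.Eventually.of_forall fun _ => (Real.exp_pos _).le), ← h₁]
    exact ENNReal.ofReal_le_ofReal h₃
  filter_upwards [hq] with ω hω s
  obtain ⟨u, -, hu⟩ := Real.exists_seq_rat_strictMono_tendsto s
  have hlim : ∀ y : ℝ, ENNReal.ofReal (Real.exp (s * y)) =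
      Filter.liminf (fun n => ENNReal.ofReal (Real.exp ((u n : ℝ) * y))) Filter.atTop := fun y =>
    (((ENNReal.continuous_ofReal.comp (Real.continuous_exp.comp
      (continuous_id.mul continuous_const))).tendsto s).comp hu.2).liminf_eq.symm
  have hlim' : Filter.Tendsto (fun n => ENNReal.ofReal (Real.exp ((u n : ℝ) ^ 2 * R ^ 2 / 2)))
      Filter.atTop (nhds (ENNReal.ofReal (Real.exp (s ^ 2 * R ^ 2 / 2)))) :=
    ((ENNReal.continuous_ofReal.comp (Real.continuous_exp.comp
      (((continuous_id.pow 2).mul continuous_const).div_const 2))).tendsto s).comp hu.2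
  rw [lintegral_congr hlim, ← hlim'.liminf_eq]
  refine (lintegral_liminf_le fun n => by fun_prop).trans ?_
  exact Filter.liminf_le_liminf (Filter.Eventually.of_forall fun n => hω (u n))

/-- Sub-Gaussianity given `H` controls the exponential moment of a quadratic polynomial in `Y`
whose constant and linear coefficients are functions of `H`. -/
lemma CondSubGaussian.lintegral_exp_quadratic_le {Ω β : Type*} {mΩ : MeasurableSpace Ω}
    [mβ : MeasurableSpace β] {μ : Measure Ω} [IsProbabilityMeasure μ] {H : Ω → β}
    (hH : Measurable H) {Y : Ω → ℝ} (hY : Measurable Y) {R : ℝ}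
    (h : CondSubGaussian μ (mβ.comap H) Y R) {w s : β → ℝ} (hw : Measurable w)
    (hs : Measurable s) {b : ℝ} (hb : 0 ≤ b) (hbR : 2 * b * R ^ 2 < 1) :
    ∫⁻ ω, ENNReal.ofReal (Real.exp (w (H ω) + (s (H ω) * Y ω + b * Y ω ^ 2))) ∂μ ≤
      ENNReal.ofReal (√(1 - 2 * b * R ^ 2))⁻¹ *
        ∫⁻ ω, ENNReal.ofReal
          (Real.exp (w (H ω) + s (H ω) ^ 2 * R ^ 2 / (2 * (1 - 2 * b * R ^ 2)))) ∂μ := by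
  -- Disintegrate the joint law of `H` and `Y`, then use the bound for each conditional law.
  let κ := ProbabilityTheory.condDistrib Y H μ
  let f : β × ℝ → ENNReal := fun p =>
    ENNReal.ofReal (Real.exp (w p.1 + (s p.1 * p.2 + b * p.2 ^ 2)))
  have hf : Measurable f := by fun_prop
  have hdis : ∫⁻ ω, f (H ω, Y ω) ∂μ = ∫⁻ ω, ∫⁻ y, f (H ω, y) ∂(κ (H ω)) ∂μ := by
    rw [← lintegral_map hf (hH.prodMk hY),
      ← ProbabilityTheory.compProd_map_condDistrib hY.aemeasurable,
      Measure.lintegral_compProd hf]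
    exact lintegral_map (Measurable.lintegral_kernel_prod_right' (κ := κ) hf) hH
  calc ∫⁻ ω, f (H ω, Y ω) ∂μ = ∫⁻ ω, ∫⁻ y, f (H ω, y) ∂(κ (H ω)) ∂μ := hdis
    _ ≤ ∫⁻ ω, ENNReal.ofReal (√(1 - 2 * b * R ^ 2))⁻¹ * ENNReal.ofReal
          (Real.exp (w (H ω) + s (H ω) ^ 2 * R ^ 2 / (2 * (1 - 2 * b * R ^ 2)))) ∂μ := by
        refine lintegral_mono_ae ?_
        filter_upwards [h.ae_lintegral_condDistrib_le hH hY] with ω hω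
        have hb' := lintegral_exp_add_sq_le (κ (H ω)) R b (s (H ω)) hb hbR hω
        calc ∫⁻ y, f (H ω, y) ∂(κ (H ω))
            = ENNReal.ofReal (Real.exp (w (H ω))) *
                ∫⁻ y, ENNReal.ofReal (Real.exp (s (H ω) * y + b * y ^ 2)) ∂(κ (H ω)) := by
              rw [← lintegral_const_mul _ (by fun_prop)]
              refine lintegral_congr fun y => ?_
              rw [← ENNReal.ofReal_mul (Real.exp_pos _).le, ← Real.exp_add]
          _ ≤ _ := by
              refine (mul_le_mul_right hb' _).trans_eq ?_
              rw [← ENNReal.ofReal_mul (Real.exp_pos _).le, ← ENNReal.ofReal_mul (by positivity),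
                Real.exp_add]
              congr 1
              ring
    _ = _ := lintegral_const_mul _ (by fun_prop)

/-! ### Concentration of the weighted sum of the tensors -/

section History

variable {Ω : Type*} {mΩ : MeasurableSpace Ω} {N : ℕ} {d : Fin N → ℕ} {T : ℕ}
  {X : Fin T → Ω → Tensor d} {ε : Fin T → Ω → ℝ}

lemma history_le (hX : ∀ t, Measurable (X t)) (hε : ∀ t, Measurable (ε t)) (t : Fin T) :
    history X ε t ≤ mΩ :=
  sup_le (iSup_le fun s => (hX s).comap_le) (iSup_le fun s => (hε s).comap_le)

lemma measurable_history_tensor {s t : Fin T} (hst : s ≤ t) : Measurable[history X ε t] (X s) :=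
  Measurable.of_comap_le <| (le_iSup (fun s : {s : Fin T // s ≤ t} =>
    MeasurableSpace.comap (X s) inferInstance) ⟨s, hst⟩).trans le_sup_left

lemma measurable_history_noise {s t : Fin T} (hst : s < t) : Measurable[history X ε t] (ε s) :=
  Measurable.of_comap_le <| (le_iSup (fun s : {s : Fin T // s < t} =>
    MeasurableSpace.comap (ε s) inferInstance) ⟨s, hst⟩).trans le_sup_right

lemma measurable_history_partialSum (t : Fin T) :
    Measurable[history X ε t] fun ω => ∑ s : Fin T with s < t, ε s ω • X s ω := by
  refine Finset.measurable_fun_sum _ fun s hs => ?_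
  have hs' := (Finset.mem_filter.1 hs).2
  exact (measurable_history_noise hs').smul (measurable_history_tensor hs'.le)

end History

/-- Adding the term `Y • x` to `U`, where `Y` is sub-Gaussian given `U` and `x`, turns the factor
`b` of `‖U‖²` into `b / (1 - 2 b R²)`, at the cost of a constant. -/
lemma CondSubGaussian.lintegral_exp_sq_add_smul_le {Ω : Type*} {m mΩ : MeasurableSpace Ω}
    {μ : Measure Ω} [IsProbabilityMeasure μ] (hm : m ≤ mΩ) {N : ℕ} {d : Fin N → ℕ}
    {Y : Ω → ℝ} (hY : Measurable Y) {R : ℝ} (h : CondSubGaussian μ m Y R)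
    {U x : Ω → Tensor d} (hU : Measurable[m] U) (hx : Measurable[m] x)
    (hx1 : ∀ᵐ ω ∂μ, frobeniusNorm (x ω) ≤ 1)
    {b : ℝ} (hb : 0 ≤ b) (hbR : 2 * b * R ^ 2 < 1) :
    ∫⁻ ω, ENNReal.ofReal
        (Real.exp (b * tensorInner (U ω + Y ω • x ω) (U ω + Y ω • x ω))) ∂μ ≤
      ENNReal.ofReal (√(1 - 2 * b * R ^ 2))⁻¹ * ∫⁻ ω, ENNReal.ofReal
        (Real.exp (b / (1 - 2 * b * R ^ 2) * tensorInner (U ω) (U ω))) ∂μ := by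
  have hx1' : ∀ᵐ ω ∂μ, tensorInner (x ω) (x ω) ≤ 1 := by
    filter_upwards [hx1] with ω hω
    simpa using (Real.sqrt_le_left zero_le_one).1 hω
  have hk : 1 - 2 * b * R ^ 2 ≠ 0 := by linarith
  have hk0 : 0 < 1 - 2 * b * R ^ 2 := by linarith
  -- With `H = id` into `Ω` equipped with `m`, the quadratic bound applies to conditioning on `m`.
  have hquad := CondSubGaussian.lintegral_exp_quadratic_le (mβ := m) (H := id)
    (measurable_id'' hm) hY (by rwa [MeasurableSpace.comap_id])
    (w := fun ω => b * tensorInner (U ω) (U ω)) (s := fun ω => 2 * b * tensorInner (U ω) (x ω))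
    ((measurable_tensorInner hU hU).const_mul b)
    ((measurable_tensorInner hU hx).const_mul (2 * b)) hb hbR
  refine (lintegral_mono_ae ?_).trans (hquad.trans (mul_le_mul_right (lintegral_mono_ae ?_) _))
  · filter_upwards [hx1'] with ω hω
    refine ENNReal.ofReal_le_ofReal (Real.exp_le_exp.2 ?_)
    rw [tensorInner_add_smul_self, id]
    nlinarith [mul_le_mul_of_nonneg_left hω (mul_nonneg hb (sq_nonneg (Y ω)))]
  · filter_upwards [hx1'] with ω hω
    refine ENNReal.ofReal_le_ofReal (Real.exp_le_exp.2 ?_)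
    rw [id]
    have hcs : tensorInner (U ω) (x ω) ^ 2 ≤ tensorInner (U ω) (U ω) :=
      (sq_tensorInner_le _ _).trans (mul_le_of_le_one_right (tensorInner_self_nonneg _) hω)
    have e : b / (1 - 2 * b * R ^ 2) * tensorInner (U ω) (U ω) = b * tensorInner (U ω) (U ω) +
        (2 * b) ^ 2 * tensorInner (U ω) (U ω) * R ^ 2 / (2 * (1 - 2 * b * R ^ 2)) := by
      generalize hκ : 1 - 2 * b * R ^ 2 = κ at hk
      field_simp
      rw [← hκ]
      ring
    rw [e, mul_pow]
    gcongr

/-- The exponential moment of the squared norm of a partial sum. The bound is dimension-free;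
`b / (1 - 2 b R²)` with `k` rounds satisfies the hypothesis exactly when `b` with `k + 1` does. -/
lemma lintegral_exp_sq_partialSum_le {Ω : Type*} {mΩ : MeasurableSpace Ω} {μ : Measure Ω}
    [IsProbabilityMeasure μ] {N : ℕ} {d : Fin N → ℕ} {T : ℕ} {R : ℝ}
    {X : Fin T → Ω → Tensor d} {ε : Fin T → Ω → ℝ}
    (hX : ∀ t, Measurable (X t)) (hε : ∀ t, Measurable (ε t))
    (hXnorm : ∀ t, ∀ᵐ ω ∂μ, frobeniusNorm (X t ω) ≤ 1)
    (hsub : ∀ t, CondSubGaussian μ (history X ε t) (ε t) R) {k : ℕ} (hk : k ≤ T) {b : ℝ}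
    (hb : 0 ≤ b) (hbk : 2 * b * R ^ 2 * k < 1) :
    ∫⁻ ω, ENNReal.ofReal (Real.exp (b * tensorInner
        (∑ t ∈ Finset.univ.filter (fun s : Fin T => (s : ℕ) < k), ε t ω • X t ω)
        (∑ t ∈ Finset.univ.filter (fun s : Fin T => (s : ℕ) < k), ε t ω • X t ω))) ∂μ ≤
      ENNReal.ofReal (√(1 - 2 * b * R ^ 2 * k))⁻¹ := by
  induction k generalizing b with
  | zero => simp [tensorInner]
  | succ k ih =>
    let t : Fin T := ⟨k, hk⟩
    push_cast at hbk ⊢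
    have h0 : 0 ≤ 2 * b * R ^ 2 := by positivity
    have hbR : 2 * b * R ^ 2 < 1 := by nlinarith [Nat.cast_nonneg (α := ℝ) k]
    have hpos : 0 < 1 - 2 * b * R ^ 2 := by linarith
    -- This identity makes the constants of the successive rounds telescope.
    have hfactor : 1 - 2 * b * R ^ 2 * (k + 1) =
        (1 - 2 * b * R ^ 2) * (1 - 2 * (b / (1 - 2 * b * R ^ 2)) * R ^ 2 * k) := by
      field_simp
      ring
    have hset : (Finset.univ.filter fun s : Fin T => (s : ℕ) < k + 1) =
        insert t (Finset.univ.filter fun s : Fin T => (s : ℕ) < k) := by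
      ext s
      simp only [Finset.mem_filter, Finset.mem_univ, true_and, Finset.mem_insert, Fin.ext_iff, t]
      omega
    have hsum : ∀ ω, ∑ s ∈ Finset.univ.filter (fun s : Fin T => (s : ℕ) < k + 1), ε s ω • X s ω =
        (∑ s ∈ Finset.univ.filter (fun s : Fin T => (s : ℕ) < k), ε s ω • X s ω) + ε t ω • X t ω := fun ω => by
      rw [hset, Finset.sum_insert (by simp [t]), add_comm]
    simp_rw [hsum]
    have hprod : 0 < (1 - 2 * b * R ^ 2) * (1 - 2 * (b / (1 - 2 * b * R ^ 2)) * R ^ 2 * k) := by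
      rw [← hfactor]
      linarith
    refine ((hsub t).lintegral_exp_sq_add_smul_le (history_le hX hε t) (hε t)
      (measurable_history_partialSum t) (measurable_history_tensor le_rfl) (hXnorm t) hb
      hbR).trans ?_
    refine (mul_le_mul_right (ih (by omega) (by positivity)
      (by linarith [pos_of_mul_pos_right hprod hpos.le])) _).trans_eq ?_
    rw [← ENNReal.ofReal_mul (by positivity), hfactor, Real.sqrt_mul hpos.le, mul_inv]

/-- Markov's inequality for `exp (‖S‖² / (4 R² T))`, whose mean is at most `√2`. -/
lemma measureReal_sq_sum_gt_le {Ω : Type*} {mΩ : MeasurableSpace Ω} {μ : Measure Ω}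
    [IsProbabilityMeasure μ] {N : ℕ} {d : Fin N → ℕ} {T : ℕ} (hT : 1 ≤ T) {R : ℝ} (hR : 0 < R)
    {X : Fin T → Ω → Tensor d} {ε : Fin T → Ω → ℝ}
    (hX : ∀ t, Measurable (X t)) (hε : ∀ t, Measurable (ε t))
    (hXnorm : ∀ t, ∀ᵐ ω ∂μ, frobeniusNorm (X t ω) ≤ 1)
    (hsub : ∀ t, CondSubGaussian μ (history X ε t) (ε t) R) {δ : ℝ} (hδ : 0 < δ) :
    μ.real {ω | 2 * R ^ 2 * T * (Real.log 2 + 2 * Real.log (1 / δ)) <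
      tensorInner (∑ t, ε t ω • X t ω) (∑ t, ε t ω • X t ω)} ≤ δ := by
  have hT' : (0 : ℝ) < T := by exact_mod_cast hT
  -- This `b` is half of the critical value `1 / (2 R² T)`.
  set b : ℝ := 1 / (4 * R ^ 2 * T) with hb
  have hb0 : 0 < b := by positivity
  have hbT : 2 * b * R ^ 2 * T = 1 / 2 := by
    rw [hb]
    field_simp
    norm_num
  have hmom := lintegral_exp_sq_partialSum_le hX hε hXnorm hsub le_rfl hb0.le
    (by rw [hbT]; norm_num)
  have hc : (√(1 - 2 * b * R ^ 2 * T))⁻¹ = √2 := by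
    rw [hbT, ← Real.sqrt_inv]
    norm_num
  rw [hc] at hmom
  simp only [Fin.is_lt, Finset.filter_true] at hmom
  have hlevel : Real.exp (b * (2 * R ^ 2 * T * (Real.log 2 + 2 * Real.log (1 / δ)))) = √2 / δ := by
    have e : b * (2 * R ^ 2 * T * (Real.log 2 + 2 * Real.log (1 / δ))) =
        Real.log 2 / 2 + Real.log (1 / δ) := by
      rw [hb]
      field_simp
      ring
    rw [e, Real.exp_add, Real.exp_log (by positivity), ← Real.log_sqrt (by norm_num),
      Real.exp_log (by positivity), mul_one_div]
  have hmeas : Measurable fun ω => ∑ t, ε t ω • X t ω :=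
    Finset.measurable_fun_sum _ fun t _ => (hε t).smul (hX t)
  have hmarkov := meas_ge_le_lintegral_div (μ := μ) (f := fun ω => ENNReal.ofReal
      (Real.exp (b * tensorInner (∑ t, ε t ω • X t ω) (∑ t, ε t ω • X t ω))))
    ((measurable_tensorInner hmeas hmeas).const_mul b).exp.ennreal_ofReal.aemeasurable
    (ε := ENNReal.ofReal (√2 / δ)) (by simp; positivity) ENNReal.ofReal_ne_top
  refine ENNReal.toReal_le_of_le_ofReal hδ.le ((measure_mono fun ω hω => ?_).trans
    (hmarkov.trans ((ENNReal.div_le_div_right hmom _).trans_eq ?_)))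
  · rw [Set.mem_ofPred_eq, ← hlevel]
    exact ENNReal.ofReal_le_ofReal
      (Real.exp_le_exp.2 (mul_le_mul_of_nonneg_left (le_of_lt hω) hb0.le))
  · rw [← ENNReal.ofReal_div_of_pos (by positivity)]
    congr 1
    field_simp

/-! ### The bound on both norms -/

theorem lemma1 {Ω : Type*} [mΩ : MeasurableSpace Ω] (μ : Measure Ω) [IsProbabilityMeasure μ]
    (N : ℕ) (hN : 1 ≤ N) (d : Fin N → ℕ) (hd : ∀ j, 1 ≤ d j)
    (T₁ : ℕ) (hT₁ : 1 ≤ T₁)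
    (R : ℝ) (hR : 0 < R) (cR : ℝ) (hcR₀ : 0 < cR) (hcR₁ : cR ≤ 1)
    (δ : ℝ) (hδ₀ : 0 < δ) (hδ₁ : δ < 1)
    (X : Fin T₁ → Ω → Tensor d) (ε : Fin T₁ → Ω → ℝ)
    (hX : ∀ t, Measurable (X t)) (hε : ∀ t, Measurable (ε t))
    (hXnorm : ∀ t, ∀ᵐ ω ∂μ, frobeniusNorm (X t ω) ≤ 1)
    (hsub : ∀ t, CondSubGaussian μ (history X ε t) (ε t) R) :
    1 - δ ≤ μ.real {ω |
      alphaOf cR * dualNorm tensorNuclearNorm (noiseAverage X ε ω) ≤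
          lambdaReg (alphaOf cR) R δ N T₁ (maxDim d) ∧
        alphaOf cR * scaledMaxSpectralNorm (noiseAverage X ε ω) ≤
          lambdaReg (alphaOf cR) R δ N T₁ (maxDim d)} := by
  have hT : (0 : ℝ) < T₁ := by exact_mod_cast hT₁
  have hN' : (1 : ℝ) ≤ N := by exact_mod_cast hN
  have hα : 0 ≤ alphaOf cR := by rw [alphaOf]; positivity
  have hD : 1 ≤ maxDim d :=
    (hd ⟨0, hN⟩).trans (Finset.le_sup (f := d) (Finset.mem_univ (⟨0, hN⟩ : Fin N)))
  set P := Real.log (4 * T₁ * N / δ) *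
    Real.log (2 * N * ((maxDim d : ℝ) + (maxDim d : ℝ) ^ (N - 1)) / δ) with hP
  have hlog : Real.log 2 + 2 * Real.log (1 / δ) ≤ P :=
    log_two_add_le_log_mul_log hN hT₁ hD hδ₀ hδ₁
  let S : Ω → Tensor d := fun ω => ∑ t, ε t ω • X t ω
  have hmeas : Measurable S := Finset.measurable_fun_sum _ fun t _ => (hε t).smul (hX t)
  have hG : MeasurableSet {ω | 2 * R ^ 2 * T₁ * (Real.log 2 + 2 * Real.log (1 / δ)) <
      tensorInner (S ω) (S ω)} :=
    measurableSet_lt measurable_const (measurable_tensorInner hmeas hmeas)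
  have hbad := measureReal_sq_sum_gt_le hT₁ hR hX hε hXnorm hsub hδ₀
  have hcompl := probReal_compl_eq_one_sub (μ := μ) hG
  refine (show 1 - δ ≤ _ from ?_).trans (measureReal_mono (μ := μ) (s₁ := {ω |
    2 * R ^ 2 * T₁ * (Real.log 2 + 2 * Real.log (1 / δ)) < tensorInner (S ω) (S ω)}ᶜ) ?_)
  · rw [hcompl]
    exact sub_le_sub_left hbad 1
  intro ω hω
  have hω' : tensorInner (S ω) (S ω) ≤ 2 * R ^ 2 * T₁ * (Real.log 2 + 2 * Real.log (1 / δ)) :=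
    not_lt.1 hω
  have hfrob : N * frobeniusNorm (noiseAverage X ε ω) ≤ R * N / √T₁ * √(2 * P) := by
    rw [noiseAverage, frobeniusNorm_smul _ (by positivity)]
    have hS : frobeniusNorm (S ω) ≤ R * √T₁ * √(2 * P) := by
      rw [frobeniusNorm]
      refine Real.sqrt_le_iff.2 ⟨by positivity, hω'.trans ?_⟩
      have hP0 : 0 ≤ P := le_trans (add_nonneg (Real.log_nonneg (by norm_num))
        (mul_nonneg zero_le_two (Real.log_nonneg (by rw [le_div_iff₀ hδ₀]; linarith)))) hlog
      rw [mul_pow, mul_pow, Real.sq_sqrt hT.le, Real.sq_sqrt (by positivity)]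
      nlinarith [mul_le_mul_of_nonneg_left hlog (by positivity : 0 ≤ 2 * R ^ 2 * (T₁ : ℝ))]
    calc (N : ℝ) * (1 / T₁ * frobeniusNorm (S ω)) ≤ N * (1 / T₁ * (R * √T₁ * √(2 * P))) := by
          gcongr
      _ = R * N / √T₁ * √(2 * P) := by
          have : (T₁ : ℝ) = √T₁ * √T₁ := (Real.mul_self_sqrt hT.le).symm
          have h0 : √(T₁ : ℝ) ≠ 0 := (Real.sqrt_pos.2 hT).ne'
          rw [show (1 : ℝ) / T₁ = 1 / (√T₁ * √T₁) by rw [← this]]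
          field_simp
  have hlam : lambdaReg (alphaOf cR) R δ N T₁ (maxDim d) =
      alphaOf cR * (R * N / √T₁ * √(2 * P)) := by
    rw [lambdaReg, hP, mul_assoc 2]
    ring
  rw [Set.mem_ofPred_eq, hlam]
  refine ⟨mul_le_mul_of_nonneg_left (le_trans ?_ hfrob) hα,
    mul_le_mul_of_nonneg_left ((scaledMaxSpectralNorm_le _).trans hfrob) hα⟩
  exact (dualNorm_tensorNuclearNorm_le hN _).trans
    (le_mul_of_one_le_left (frobeniusNorm_nonneg _) hN')
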